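/- Conventions. Let a Lie group $G$ with Lie algebra $\mathfrak g$ act smoothly on a manifold $M$, with infinitesimal generators $v_x$ ($x\in\mathfrak g$), $v_x(p)=\frac{d}{dt}\big|_{0}\exp(-tx)\cdot p$, and let $\omega\in\Omega^{n+1}(M)$ be closed and $G$-invariant. Put $\varsigma(k)=-(-1)^{k(k+1)/2}$ and $\iota(v_1\wedge\dots\wedge v_k)=\iota_{v_k}\cdots\iota_{v_1}$. Let $d_{\mathfrak g}$ be the Chevalley–Eilenberg differential $(d_{\mathfrak g}F)(x_1,\dots,x_{k+1})=\sum_{i<j}(-1)^{i+j}F([x_i,x_j],x_1,\dots,\widehat{x_i},\dots,\widehat{x_j},\dots,x_{k+1})$, and let $d_{tot}=d_{\mathfrak g}+(-1)^kd$ on $\wedge^k\mathfrak g^*\otimes\Omega(M)$, $k\ge1$. For $\sigma\in\Omega^N(M)$ let $\widetilde\sigma=\sum_{k=1}^{N}(-1)^{k-1}\sigma_k$ with $\sigma_k(x_1,\dots,x_k)=\iota(v_{x_1}\wedge\dots\wedge v_{x_k})\sigma$. A (homotopy) moment map for $\omega$ consists of linear maps $f_k\colon\wedge^k\mathfrak g\to\Omega^{n-k}(M)$,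 $1\le k\le n$, with $d f_1(x)=-\iota_{v_x}\omega$, with $-(d_{\mathfrak g}f_{k-1})(x_1,\dots,x_k)=d f_k(x_1,\dots,x_k)+\varsigma(k)\,\iota(v_{x_1}\wedge\dots\wedge v_{x_k})\omega$ for $2\le k\le n$, and with $-(d_{\mathfrak g}f_n)(x_1,\dots,x_{n+1})=\varsigma(n+1)\,\iota(v_{x_1}\wedge\dots\wedge v_{x_{n+1}})\omega$. It is equivariant if every $f_k$ is $G$-equivariant. Write $\varphi=\sum_k\varsigma(k)f_k$. Pairs $(\omega,f)$ and $(\omega',f')$ are equivalent if there are $\eta\in(\wedge^{\ge1}\mathfrak g^*\otimes\Omega(M))_{n-1}$ and $\alpha\in\Omega^n(M)^G$ with $\omega'-\omega=d\alpha$ and $\varphi'-\varphi=d_{tot}\eta+\widetilde\alpha$. If $\mu\colon\mathfrak g\to\Omega^{n-1}(M)$ is linear and equivariant and $\omega-\mu$ is a cocycle of the Cartan model $\big((\Omega(M)\otimes S\mathfrak g^*)^G,d_G\big)$, where $(d_GA)(x)=d(A(x))-\iota_{v_x}A(x)$, then the moment map arising from $\omega-\mu$ is $f_k(x_1,\dots,x_k)=\varsigma(k)\,\iota(v_{x_1}\wedge\dots\wedge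 v_{x_{k-1}})\mu(x_k)$. Proposition. Let $G=S^1\times S^1$ act on $M=S^1\times S^1\times\mathbb R$ by rotating the first two factors, and let $\omega=d\theta_1\wedge d\theta_2\wedge dz$ (a closed $G$-invariant $3$-form on $M$, so $n=2$). Then there is an equivariant homotopy moment map $f$ for $\omega$ such that $(\omega,f)$ is not equivalent to $(\omega,f')$ for any moment map $f'$ for $\omega$ that arises from a Cartan cocycle of the form $\omega-\mu$. In particular, there is a closed $3$-form having an equivariant moment map that is not equivalent to any moment map arising from such a Cartan cocycle. -/

import Mathlib

noncomputable section

namespace MomentMap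

open Set
open scoped Manifold

/-! ### Differential forms on a manifold -/

section Forms

variable {E : Type*} [NormedAddCommGroup E] [NormedSpace ℝ E] {H : Type*} [TopologicalSpace H]
variable (I : ModelWithCorners ℝ E H)
variable (M : Type*) [TopologicalSpace M] [ChartedSpace H M]

/-- A (not necessarily smooth) differential form of degree `l` on `M`. -/
abbrev RawForm (l : ℕ) : Type _ := ∀ p : M, TangentSpace I p [⋀^Fin l]→L[ℝ] ℝ

/-- A (not necessarily smooth) vector field on `M`. -/
abbrev RawVectorField : Type _ := ∀ p : M, TangentSpace I p

variable {I M}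

/-- The coordinate expression of a form in the preferred chart at `p₀`: the pull-back of the form
along the inverse of the chart, as a form on the model vector space. -/
def chartRep {l : ℕ} (σ : RawForm I M l) (p₀ : M) (y : E) : E [⋀^Fin l]→L[ℝ] ℝ :=
  (σ ((extChartAt I p₀).symm y)).compContinuousLinearMap
    ((mfderivWithin 𝓘(ℝ, E) I (extChartAt I p₀).symm (range I) y).comp
      (NormedSpace.fromTangentSpace y).symm.toContinuousLinearMap)

/-- A form is smooth if all its coordinate expressions are. -/
def IsSmoothForm {l : ℕ} (σ : RawForm I M l) : Prop :=
  ∀ p₀ : M, ContDiffOn ℝ (⊤ : ℕ∞) (chartRep σ p₀) (extChartAt I p₀).target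

variable (I M) in
/-- The vector space `Ω^l(M)` of smooth differential forms of degree `l`. -/
def SmoothForm (l : ℕ) : Submodule ℝ (RawForm I M l) where
  carrier := {σ | IsSmoothForm σ}
  zero_mem' := fun _ => contDiffOn_const (c := (0 : E [⋀^Fin l]→L[ℝ] ℝ))
  add_mem' := fun hσ hτ p₀ => (hσ p₀).add (hτ p₀)
  smul_mem' := fun c _ hσ p₀ => (hσ p₀).const_smul c

/-- The exterior derivative, computed at each point in the preferred chart there. -/
def extDer {l : ℕ} (σ : RawForm I M l) : RawForm I M (l + 1) := fun p =>
  (extDerivWithin (chartRep σ p) (range I) (extChartAt I p p)).compContinuousLinearMap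
    (mvfderiv I (extChartAt I p) p)

/-- The interior product `ι_v σ = σ(v, ⋅, …, ⋅)`. -/
def interior {l : ℕ} (v : RawVectorField I M) (σ : RawForm I M (l + 1)) : RawForm I M l := fun p =>
  ContinuousAlternatingMap.curryLeft (E := E) (σ p) (v p)

theorem interior_apply {l : ℕ} (v : RawVectorField I M) (σ : RawForm I M (l + 1)) (p : M)
    (w : Fin l → TangentSpace I p) : interior v σ p w = σ p (Fin.cons (v p) w) := rfl

/-- The contraction `ι(v₁ ∧ ⋯ ∧ v_k) σ = ι_{v_k} ⋯ ι_{v₁} σ = σ(v₁, …, v_k, ⋅, …, ⋅)`. -/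
def iterInterior {l : ℕ} : ∀ k : ℕ, (Fin k → RawVectorField I M) → RawForm I M (l + k) →
    RawForm I M l
  | 0, _, σ => σ
  | k + 1, v, σ => iterInterior k (Fin.tail v) (interior (v 0) σ)

/-- The contraction `ι(v₁ ∧ ⋯ ∧ v_k) σ` of a form of degree `N = l + k`. -/
def contract {N : ℕ} (k l : ℕ) (h : N = l + k) (v : Fin k → RawVectorField I M)
    (σ : RawForm I M N) : RawForm I M l :=
  iterInterior k v (h ▸ σ)

/-- The pull-back of a form by a map `ψ : M → M`. -/
def pullback {l : ℕ} (ψ : M → M) (σ : RawForm I M l) : RawForm I M l := fun p =>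
  (σ (ψ p)).compContinuousLinearMap (mfderiv I I ψ p)

/-- The wedge product `a₁ ∧ ⋯ ∧ a_k` of `1`-forms (given as fields of covectors); its value on
`w₁, …, w_k` is the determinant of the matrix `a_i(w_j)`. -/
def wedge {k : ℕ} (a : Fin k → ∀ p : M, TangentSpace I p →L[ℝ] ℝ) : RawForm I M k := fun p =>
  ContinuousMultilinearMap.alternatization
    ((ContinuousMultilinearMap.mkPiAlgebra ℝ (Fin k) ℝ).compContinuousLinearMap fun i => a i p)

end Forms

/-! ### Lie group actions, the double complex and homotopy moment maps -/

section Action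

variable {EG : Type*} [NormedAddCommGroup EG] [NormedSpace ℝ EG]
  {HG : Type*} [TopologicalSpace HG] {J : ModelWithCorners ℝ EG HG}
  {G : Type*} [TopologicalSpace G] [ChartedSpace HG G] [Group G]
  {E : Type*} [NormedAddCommGroup E] [NormedSpace ℝ E]
  {H : Type*} [TopologicalSpace H] {I : ModelWithCorners ℝ E H}
  {M : Type*} [TopologicalSpace M] [ChartedSpace H M] [MulAction G M]

/-- The infinitesimal generator `v_x` of the action, `v_x(p) = d/dt exp(-t x) • p` at `t = 0`. With
this sign `x ↦ v_x` is a morphism of Lie algebras for a left action of `G`. -/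
def generator (x : GroupLieAlgebra J G) : RawVectorField I M := fun p =>
  -(mfderiv J I (fun g : G => g • p) 1 : EG →L[ℝ] E) x

/-- The adjoint action of `G` on its Lie algebra. -/
def adjoint (g : G) (x : GroupLieAlgebra J G) : GroupLieAlgebra J G :=
  (mfderiv J J (fun h : G => g * h * g⁻¹) 1 : EG →L[ℝ] EG) x

variable (G) in
/-- Invariance of a form under the action of `G`. -/
def IsInvariant {l : ℕ} (σ : RawForm I M l) : Prop :=
  ∀ g : G, pullback (fun p : M => g • p) σ = σ

variable (J G I M) in
/-- The elements of `∧^k 𝔤* ⊗ Ω^l(M)`, as alternating `k`-linear maps on `𝔤`. -/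
abbrev Cochain (k l : ℕ) : Type _ := GroupLieAlgebra J G [⋀^Fin k]→ₗ[ℝ] SmoothForm I M l

variable (J G I M) in
/-- The degree `n` part `(∧^{≥ 1} 𝔤* ⊗ Ω(M))_n` of the total complex. An element `φ` has the
components `φ_{k+1} = φ k l _ ∈ ∧^{k+1} 𝔤* ⊗ Ω^l(M)`, one for each `k, l ≥ 0` with
`(k + 1) + l = n`. -/
abbrev TotalCochain (n : ℕ) : Type _ := ∀ k l : ℕ, k + 1 + l = n → Cochain J G I M (k + 1) l

/-- The Chevalley-Eilenberg differential (with trivial coefficients),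
`(d_𝔤 F)(x₁, …, x_{k+2}) = ∑_{i < j} (-1)^{i+j} F([x_i, x_j], x₁, …, x̂_i, …, x̂_j, …, x_{k+2})`. -/
def ceDifferential {k l : ℕ} (F : Cochain J G I M (k + 1) l) (x : Fin (k + 2) → GroupLieAlgebra J G) :
    SmoothForm I M l :=
  ∑ j : Fin (k + 2), ∑ i : Fin (k + 1),
    if i.castSucc < j then
      (-1 : ℝ) ^ ((i : ℕ) + (j : ℕ)) •
        F (Fin.cons ⁅x i.castSucc, x j⁆ (i.removeNth (j.removeNth x)))
    else 0

/-- The total differential, `d_𝔤 + (-1)^k d` on `∧^k 𝔤* ⊗ Ω(M)`, on the complex that starts at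
`k = 1`. The component in `∧^{k+1} 𝔤* ⊗ Ω^l(M)` is given by its values on `𝔤^{k+1}`. -/
def totalDifferential {n : ℕ} (φ : TotalCochain J G I M n) :
    ∀ k l : ℕ, k + 1 + l = n + 1 → (Fin (k + 1) → GroupLieAlgebra J G) → RawForm I M l
  | 0, 0, _, _ => 0
  | 0, l + 1, h, x => -extDer (φ 0 l (by omega) x : RawForm I M l)
  | k + 1, 0, h, x => (ceDifferential (φ k 0 (by omega)) x : RawForm I M 0)
  | k + 1, l + 1, h, x =>
      (ceDifferential (φ k (l + 1) (by omega)) x : RawForm I M (l + 1)) +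
        (-1 : ℝ) ^ (k + 2) • extDer (φ (k + 1) l (by omega) x : RawForm I M l)

/-- `σ̃ = ∑_{k ≥ 1} (-1)^{k-1} σ_k`, where `σ_k(x₁, …, x_k) = ι(v_{x₁} ∧ ⋯ ∧ v_{x_k}) σ`. -/
def tilde {n : ℕ} (σ : RawForm I M n) (k l : ℕ) (h : k + 1 + l = n)
    (x : Fin (k + 1) → GroupLieAlgebra J G) : RawForm I M l :=
  (-1 : ℝ) ^ k • contract (k + 1) l (by omega) (fun i => generator (x i)) σ

/-- The sign `ς(k) = -(-1)^{k(k+1)/2}`. -/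
def varsigma (k : ℕ) : ℝ := -(-1) ^ (k * (k + 1) / 2)

/-- `f` consists of the components `f_{k+1} = f k l _ : ∧^{k+1} 𝔤 → Ω^{n-(k+1)}(M)` of a homotopy
moment map `𝔤 → L_∞(M, ω)` for the action of `G` on `(M, ω)`, where `ω` is an `(n + 1)`-form.
The left-hand sides of the last two equations are
`∑_{i < j} (-1)^{i+j+1} f_{k-1}([x_i, x_j], x₁, …, x̂_i, …, x̂_j, …, x_k)` for `k = j + 2`. -/
structure IsMomentMap {n : ℕ} (ω : RawForm I M (n + 1)) (f : TotalCochain J G I M n) : Prop where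
  hamiltonian : ∀ (l : ℕ) (h : 0 + 1 + l = n) (x : GroupLieAlgebra J G),
    extDer (f 0 l h ![x] : RawForm I M l) =
      -contract 1 (l + 1) (by omega) ![generator x] ω
  bracket : ∀ (j l : ℕ) (h : j + 1 + (l + 1) = n) (x : Fin (j + 2) → GroupLieAlgebra J G),
    -(ceDifferential (f j (l + 1) h) x : RawForm I M (l + 1)) =
      extDer (f (j + 1) l (by omega) x : RawForm I M l) +
        varsigma (j + 2) • contract (j + 2) (l + 1) (by omega) (fun i => generator (x i)) ω
  top : ∀ (j : ℕ) (h : j + 1 + 0 = n) (x : Fin (j + 2) → GroupLieAlgebra J G),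
    -(ceDifferential (f j 0 h) x : RawForm I M 0) =
      varsigma (j + 2) • contract (j + 2) 0 (by omega) (fun i => generator (x i)) ω

/-- Equivariance of all components: `f_k(Ad_g x₁, …, Ad_g x_k) = (g⁻¹)^* f_k(x₁, …, x_k)`. -/
def IsEquivariant {n : ℕ} (f : TotalCochain J G I M n) : Prop :=
  ∀ (k l : ℕ) (h : k + 1 + l = n) (g : G) (x : Fin (k + 1) → GroupLieAlgebra J G),
    (f k l h (fun i => adjoint g (x i)) : RawForm I M l) =
      pullback (fun p : M => g⁻¹ • p) (f k l h x : RawForm I M l)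

/-- The pairs `(ω, f)` and `(ω', f')` are equivalent: for the associated elements
`φ_k = ς(k) f_k` and `φ'_k = ς(k) f'_k` of the total complex there are `η` in the total complex and
a `G`-invariant form `α` with `ω' - ω = dα` and `φ' - φ = d_tot η + α̃`. -/
def AreEquivalent {m : ℕ} (ω : SmoothForm I M (m + 2)) (f : TotalCochain J G I M (m + 1))
    (ω' : SmoothForm I M (m + 2)) (f' : TotalCochain J G I M (m + 1)) : Prop :=
  ∃ (η : TotalCochain J G I M m) (α : SmoothForm I M (m + 1)),
    IsInvariant G (α : RawForm I M (m + 1)) ∧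
    (ω' : RawForm I M (m + 2)) - (ω : RawForm I M (m + 2)) = extDer (α : RawForm I M (m + 1)) ∧
    ∀ (k l : ℕ) (h : k + 1 + l = m + 1) (x : Fin (k + 1) → GroupLieAlgebra J G),
      varsigma (k + 1) • (f' k l h x : RawForm I M l) -
          varsigma (k + 1) • (f k l h x : RawForm I M l) =
        totalDifferential η k l h x + tilde (α : RawForm I M (m + 1)) k l h x

/-! ### The Cartan model -/

variable (I M) in
/-- Inhomogeneous forms, as families of their homogeneous parts. -/
abbrev InhomForm : Type _ := ∀ l : ℕ, RawForm I M l

/-- The exterior derivative of inhomogeneous forms. -/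
def inhomExtDer (σ : InhomForm I M) : InhomForm I M
  | 0 => 0
  | l + 1 => extDer (σ l)

/-- The interior product of inhomogeneous forms. -/
def inhomInterior (v : RawVectorField I M) (σ : InhomForm I M) : InhomForm I M := fun l =>
  interior v (σ (l + 1))

/-- The Cartan differential `d_G = d ⊗ 1 - ∑ ι_{v_{x_i}} ⊗ ξ^i`, where the elements of
`Ω(M) ⊗ S𝔤*` are seen as polynomial maps `A : 𝔤 → Ω(M)`: `(d_G A)(x) = d (A x) - ι_{v_x} (A x)`. -/
def cartanDifferential (A : GroupLieAlgebra J G → InhomForm I M) :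
    GroupLieAlgebra J G → InhomForm I M := fun x =>
  inhomExtDer (A x) - inhomInterior (generator x) (A x)

/-- `ω - μ` is a cocycle of the Cartan model `((Ω(M) ⊗ S𝔤*)^G, d_G)`: the form `ω` is invariant, the
linear map `μ : 𝔤 → Ω^m(M)` is equivariant, and `d_G (ω - μ) = 0`. -/
structure IsCartanCocycle {m : ℕ} (ω : SmoothForm I M (m + 2))
    (μ : GroupLieAlgebra J G →ₗ[ℝ] SmoothForm I M m) : Prop where
  invariant : IsInvariant G (ω : RawForm I M (m + 2))
  equivariant : ∀ (g : G) (x : GroupLieAlgebra J G),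
    (μ (adjoint g x) : RawForm I M m) = pullback (fun p : M => g⁻¹ • p) (μ x : RawForm I M m)
  closed : cartanDifferential (fun x : GroupLieAlgebra J G =>
    (Pi.single (m + 2) (ω : RawForm I M (m + 2)) - Pi.single m (μ x : RawForm I M m) :
      InhomForm I M)) = 0

/-- `f` is the moment map induced by the Cartan cocycle `ω - μ`:
`f_k(x₁, …, x_k) = ς(k) ι(v_{x₁} ∧ ⋯ ∧ v_{x_{k-1}}) μ(x_k)` for `1 ≤ k ≤ n`, where `n = m + 1`. -/
def ArisesFrom {m : ℕ} (μ : GroupLieAlgebra J G →ₗ[ℝ] SmoothForm I M m)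
    (f : TotalCochain J G I M (m + 1)) : Prop :=
  ∀ (k l : ℕ) (h : k + 1 + l = m + 1) (x : Fin (k + 1) → GroupLieAlgebra J G),
    (f k l h x : RawForm I M l) =
      varsigma (k + 1) • contract k l (by omega) (fun i => generator (x i.castSucc))
        (μ (x (Fin.last k)) : RawForm I M m)

end Action

/-! ### The torus `S¹ × S¹` acting on `S¹ × S¹ × ℝ` -/

section Example

/-- The Lie group `S¹ × S¹`. -/
abbrev Torus : Type := Circle × Circle

/-- The manifold `S¹ × S¹ × ℝ`. -/
abbrev TorusLine : Type := Circle × Circle × ℝ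

/-- The model of `S¹ × S¹`. -/
abbrev torusModel := (𝓡 1).prod (𝓡 1)

/-- The model of `S¹ × S¹ × ℝ`. -/
abbrev torusLineModel := (𝓡 1).prod ((𝓡 1).prod 𝓘(ℝ, ℝ))

/-- `S¹ × S¹` acts on `S¹ × S¹ × ℝ` by rotations of the first two factors. -/
instance : MulAction Torus TorusLine where
  smul g p := (g.1 * p.1, g.2 * p.2.1, p.2.2)
  one_smul p := by
    change ((1 : Circle) * p.1, (1 : Circle) * p.2.1, p.2.2) = p
    simp
  mul_smul g h p := by
    change ((g.1 * h.1) * p.1, (g.2 * h.2) * p.2.1, p.2.2) =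
      (g.1 * (h.1 * p.1), g.2 * (h.2 * p.2.1), p.2.2)
    simp [mul_assoc]

instance : ContMDiffSMul torusModel torusLineModel (⊤ : ℕ∞) Torus TorusLine where
  contMDiff_smul := by
    have h1 : ContMDiff (torusModel.prod torusLineModel) (𝓡 1) (⊤ : ℕ∞)
        (fun q : Torus × TorusLine => q.1.1 * q.2.1) :=
      (contMDiff_fst.comp contMDiff_fst).mul (contMDiff_fst.comp contMDiff_snd)
    have h2 : ContMDiff (torusModel.prod torusLineModel) (𝓡 1) (⊤ : ℕ∞)
        (fun q : Torus × TorusLine => q.1.2 * q.2.2.1) :=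
      (contMDiff_snd.comp contMDiff_fst).mul
        (contMDiff_fst.comp (contMDiff_snd.comp contMDiff_snd))
    have h3 : ContMDiff (torusModel.prod torusLineModel) 𝓘(ℝ, ℝ) (⊤ : ℕ∞)
        (fun q : Torus × TorusLine => q.2.2.2) :=
      contMDiff_snd.comp (contMDiff_snd.comp contMDiff_snd)
    exact h1.prodMk (h2.prodMk h3)

/-- The `1`-form `dθ` for a circle-valued function `u = exp(i θ)`, that is `dθ = Im(ū du)`. -/
def angleForm (u : TorusLine → Circle) (p : TorusLine) : TangentSpace torusLineModel p →L[ℝ] ℝ :=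
  Complex.imCLM.comp ((starRingEnd ℂ (u p : ℂ)) •
    mvfderiv torusLineModel (fun q => (u q : ℂ)) p)

/-- The `1`-form `dz`. -/
def dz (p : TorusLine) : TangentSpace torusLineModel p →L[ℝ] ℝ :=
  mvfderiv torusLineModel (fun q : TorusLine => q.2.2) p

/-- The `3`-form `dθ₁ ∧ dθ₂ ∧ dz`. -/
def torusVolume : RawForm torusLineModel TorusLine 3 :=
  wedge ![angleForm fun q => q.1, angleForm fun q => q.2.1, dz]

end Example

end MomentMap

end

open MomentMap

/-!
The group acts by translations in the angles `θ₁, θ₂`, so `dθ₁`, `dθ₂` and `dz` are invariant and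
take the constant values `-x₁`, `-x₂` and `0` on the generator `v_x`.  The moment map is
`f₁(x) = x₁ (dθ₁ - z dθ₂) + x₂ z dθ₁` and `f₂(x, y) = (x₂ y₁ - x₁ y₂) z`
(`torusMoment`, `isMomentMap_torusMoment`).  The closed summand `x₁ dθ₁` of `f₁` does not affect the
moment map equations; it is what obstructs an equivalence with a moment map of Cartan type.

If `ω - μ` is a Cartan cocycle, the component of `d_G (ω - μ) = 0` in degree `0` says that
`ι_{v_x} μ(x) = 0` (`interior_eq_zero_of_isCartanCocycle`).  If `f` is equivalent to the moment map
induced by `μ`, then `μ(x) - f₁(x) = -dη(x) + ι_{v_x} α` for a linear map `η : 𝔤 → C^∞(M)` and a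
`2`-form `α`.  Contraction with `v_x` kills `α`, hence `ι_{v_x} f₁(x)` is the derivative of the
function `η(x)` along `v_x`.  For `x = e₁` the orbits of `v_x` are circles, so `η(x)` has a critical
point along an orbit and this derivative vanishes somewhere
(`exists_mvfderiv_generator_basis₁_eq_zero`), whereas `ι_{v_x} f₁(x) = -1` everywhere
(`not_areEquivalent_torusMoment`).

The exterior derivatives are computed in the preferred charts.  For `g dθ`, with `U` the coordinate
expression of `exp(i θ)`, closedness of `dθ` comes from `|U| = 1`, which makes the derivatives of
`U` real multiples of `i U` (`fderiv_angle`).  The Chevalley-Eilenberg differential vanishes since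
inversion in a commutative Lie group is a homomorphism with derivative `-1`, which forces
`-[x, y] = [-x, -y]` (`bracket_eq_zero_of_comm`).
-/

noncomputable section
namespace MomentMap
open Set Filter
open scoped Manifold Topology

/-! ### Forms and exterior derivatives in charts -/

section Charts

/-- Evaluations on tuples of basis vectors embed the space of alternating maps linearly in a
finite-dimensional space, so smoothness may be tested on them. -/
theorem contDiffOn_continuousAlternatingMap_iff_apply {E F : Type*} [NormedAddCommGroup E]
    [NormedSpace ℝ E] [FiniteDimensional ℝ E] [NormedAddCommGroup F] [NormedSpace ℝ F]
    {n : WithTop ℕ∞} {l : ℕ} {s : Set F} {σ : F → E [⋀^Fin l]→L[ℝ] ℝ} :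
    ContDiffOn ℝ n σ s ↔ ∀ v : Fin l → E, ContDiffOn ℝ n (fun y => σ y v) s := by
  constructor
  · intro h v
    exact (ContinuousAlternatingMap.apply ℝ E ℝ v).contDiff.comp_contDiffOn h
  · intro h
    let b := Module.finBasis ℝ E
    let ev : (E [⋀^Fin l]→L[ℝ] ℝ) →ₗ[ℝ] ((Fin l → Fin (Module.finrank ℝ E)) → ℝ) :=
      LinearMap.pi fun i => (ContinuousAlternatingMap.apply ℝ E ℝ fun j => b (i j)).toLinearMap
    have hev : Function.Injective ev := by
      intro A B hAB
      apply ContinuousAlternatingMap.toAlternatingMap_injective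
      refine Module.Basis.ext_alternating b fun i _ => congrFun hAB i
    obtain ⟨g, hg⟩ := ev.exists_leftInverse_of_injective (LinearMap.ker_eq_bot.mpr hev)
    have hσ : σ = fun y => g.toContinuousLinearMap (fun i => σ y fun j => b (i j)) := by
      funext y
      exact (LinearMap.congr_fun hg (σ y)).symm
    rw [hσ]
    exact g.toContinuousLinearMap.contDiff.comp_contDiffOn
      (contDiffOn_pi.mpr fun i => h fun j => b (i j))

variable {E : Type*} [NormedAddCommGroup E] [NormedSpace ℝ E] {H : Type*} [TopologicalSpace H]
variable {I : ModelWithCorners ℝ E H}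
variable {M : Type*} [TopologicalSpace M] [ChartedSpace H M]
variable {F : Type*} [NormedAddCommGroup F] [NormedSpace ℝ F]

/-- The derivative at `y` of the inverse of the preferred chart at `p₀`; it sends a basis of the
model space to the coordinate frame at the point with coordinates `y`. -/
def chartFrame (I : ModelWithCorners ℝ E H) (p₀ : M) (y : E) :
    E →L[ℝ] TangentSpace I ((extChartAt I p₀).symm y) :=
  (mfderivWithin 𝓘(ℝ, E) I (extChartAt I p₀).symm (range I) y).comp
      (NormedSpace.fromTangentSpace y).symm.toContinuousLinearMap

theorem chartRep_apply {l : ℕ} (σ : RawForm I M l) (p₀ : M) (y : E) (v : Fin l → E) :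
    chartRep σ p₀ y v = σ ((extChartAt I p₀).symm y) fun i => chartFrame I p₀ y (v i) := rfl

theorem contDiffOn_comp_extChartAt_symm [IsManifold I (⊤ : ℕ∞) M] {h : M → F}
    (hh : ContMDiff I 𝓘(ℝ, F) (⊤ : ℕ∞) h) (p₀ : M) :
    ContDiffOn ℝ (⊤ : ℕ∞) (h ∘ (extChartAt I p₀).symm) (extChartAt I p₀).target :=
  (hh.comp_contMDiffOn (contMDiffOn_extChartAt_symm p₀)).contDiffOn

theorem wedge_apply {k : ℕ} (a : Fin k → ∀ p : M, TangentSpace I p →L[ℝ] ℝ) (p : M)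
    (w : Fin k → TangentSpace I p) :
    wedge a p w = (Matrix.of fun i j => a i p (w j)).det := by
  rw [wedge, ← Matrix.det_transpose, Matrix.det_apply,
    ContinuousMultilinearMap.alternatization_apply_apply]
  refine Finset.sum_congr rfl fun τ _ => ?_
  simp

theorem isSmoothForm_iff [FiniteDimensional ℝ E] {l : ℕ} {σ : RawForm I M l} :
    IsSmoothForm σ ↔ ∀ (p₀ : M) (v : Fin l → E), ContDiffOn ℝ (⊤ : ℕ∞)
      (fun y => σ ((extChartAt I p₀).symm y) fun i => chartFrame I p₀ y (v i))
      (extChartAt I p₀).target :=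
  forall_congr' fun _ => contDiffOn_continuousAlternatingMap_iff_apply

theorem mvfderiv_clm_comp {F' : Type*} [NormedAddCommGroup F'] [NormedSpace ℝ F'] (L : F →L[ℝ] F')
    {h : M → F} {p : M} (hh : MDifferentiableAt I 𝓘(ℝ, F) h p) (v : TangentSpace I p) :
    mvfderiv I (fun q => L (h q)) p v = L (mvfderiv I h p v) := by
  have h1 := mfderiv_comp_apply p (L.differentiableAt.mdifferentiableAt (x := h p)) hh v
  rw [mfderiv_eq_fderiv, L.fderiv] at h1
  exact h1

/-- The tangent space at `p` is the model space, identified by means of the preferred chart at `p`,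
so the derivative of that chart at `p` is the identity. -/
theorem mvfderiv_extChartAt_self [IsManifold I 1 M] (p : M) (v : E) :
    mvfderiv I (extChartAt I p) p v = v := by
  change mfderiv I 𝓘(ℝ, E) (extChartAt I p) p v = v
  rw [mfderiv_extChartAt_self]
  rfl

variable [I.Boundaryless]

theorem differentiableAt_chartRep {l : ℕ} {σ : RawForm I M l} (hσ : IsSmoothForm σ) (p : M) :
    DifferentiableAt ℝ (chartRep σ p) (extChartAt I p p) :=
  ((hσ p).differentiableOn (by simp)).differentiableAt (extChartAt_target_mem_nhds p)

theorem mvfderiv_eq_fderiv_extChartAt {h : M → F} {p : M} (hh : MDifferentiableAt I 𝓘(ℝ, F) h p)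
    (v : E) : mvfderiv I h p v = fderiv ℝ (h ∘ (extChartAt I p).symm) (extChartAt I p p) v := by
  have h1 := hh.mvfderiv
  rw [I.range_eq_univ, fderivWithin_univ] at h1
  exact DFunLike.congr_fun h1 v

variable [IsManifold I 1 M]

theorem mvfderiv_chartFrame {h : M → F} (hh : MDifferentiable I 𝓘(ℝ, F) h) (p₀ : M) {y : E}
    (hy : y ∈ (extChartAt I p₀).target) (v : E) :
    mvfderiv I h ((extChartAt I p₀).symm y) (chartFrame I p₀ y v) =
      fderiv ℝ (h ∘ (extChartAt I p₀).symm) y v := by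
  have h1 := mdifferentiableWithinAt_extChartAt_symm hy
  rw [I.range_eq_univ, mdifferentiableWithinAt_univ] at h1
  have h2 := mfderiv_comp_apply y (hh _) h1 v
  rw [mfderiv_eq_fderiv] at h2
  refine Eq.trans ?_ h2.symm
  simp only [chartFrame, I.range_eq_univ, mfderivWithin_univ]
  rfl

theorem extDer_apply {l : ℕ} {σ : RawForm I M l} (hσ : IsSmoothForm σ)
    (p : M) (w : Fin (l + 1) → E) :
    extDer σ p w = ∑ i, (-1) ^ i.val •
      fderiv ℝ (fun y => chartRep σ p y (i.removeNth w)) (extChartAt I p p) (w i) := by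
  rw [extDer, I.range_eq_univ, extDerivWithin_univ,
    ← extDeriv_apply (differentiableAt_chartRep hσ p) w]
  refine congrArg (extDeriv (chartRep σ p) (extChartAt I p p)) ?_
  funext i
  exact mvfderiv_extChartAt_self p (w i)

theorem mdifferentiable_zeroForm {σ : RawForm I M 0} (hσ : IsSmoothForm σ) :
    MDifferentiable I 𝓘(ℝ, ℝ) fun q => σ q ![] := by
  intro p
  have h1 : DifferentiableAt ℝ (fun y => chartRep σ p y ![]) (extChartAt I p p) :=
    (ContinuousAlternatingMap.apply ℝ E ℝ ![]).differentiableAt.comp _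
      (differentiableAt_chartRep hσ p)
  have h2 := h1.mdifferentiableAt.comp p (mdifferentiableAt_extChartAt (mem_chart_source H p))
  refine h2.congr_of_eventuallyEq ?_
  filter_upwards [extChartAt_source_mem_nhds (I := I) p] with q hq
  rw [Function.comp_apply, chartRep_apply, (extChartAt I p).left_inv hq]
  exact congrArg (σ q) (Subsingleton.elim _ _)

theorem extDer_zeroForm_apply {σ : RawForm I M 0} (hσ : IsSmoothForm σ) (p : M)
    (w : Fin 1 → E) : extDer σ p w = mvfderiv I (fun q => σ q ![]) p (w 0) := by
  rw [extDer_apply hσ, mvfderiv_eq_fderiv_extChartAt (mdifferentiable_zeroForm hσ p)]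
  refine (Fin.sum_univ_one _).trans ?_
  rw [Fin.val_zero, pow_zero, one_smul]
  congr 2
  funext y
  rw [chartRep_apply]
  exact congrArg (σ _) (Subsingleton.elim _ _)

variable (I M) in
/-- The exterior derivative as a linear map on smooth forms. -/
def extDerₗ (l : ℕ) : SmoothForm I M l →ₗ[ℝ] RawForm I M (l + 1) where
  toFun σ := extDer (σ : RawForm I M l)
  map_add' σ τ := by
    funext p
    have h : extDerivWithin (chartRep ((σ + τ : SmoothForm I M l) : RawForm I M l) p) (range I)
        (extChartAt I p p) = _ :=
      extDerivWithin_add (I.uniqueDiffOn.uniqueDiffWithinAt (mem_range_self _))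
        (differentiableAt_chartRep σ.2 p).differentiableWithinAt
        (differentiableAt_chartRep τ.2 p).differentiableWithinAt
    ext w
    change extDerivWithin _ _ _ _ = _
    rw [h]
    rfl
  map_smul' c σ := by
    funext p
    have h : extDerivWithin (chartRep ((c • σ : SmoothForm I M l) : RawForm I M l) p) (range I)
        (extChartAt I p p) = _ :=
      extDerivWithin_smul c (chartRep (σ : RawForm I M l) p)
        (by rw [I.range_eq_univ]; exact uniqueDiffWithinAt_univ)
    ext w
    change extDerivWithin _ _ _ _ = _
    rw [h]
    rfl

theorem contDiffOn_covector_mvfderiv [IsManifold I (⊤ : ℕ∞) M] {h : M → F}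
    (hh : ContMDiff I 𝓘(ℝ, F) (⊤ : ℕ∞) h)
    (p₀ : M) (v : E) : ContDiffOn ℝ (⊤ : ℕ∞)
      (fun y => mvfderiv I h ((extChartAt I p₀).symm y) (chartFrame I p₀ y v))
      (extChartAt I p₀).target := by
  have h1 := (contDiffOn_comp_extChartAt_symm hh p₀).fderiv_of_isOpen
    (isOpen_extChartAt_target p₀) (m := (⊤ : ℕ∞)) (by simp)
  exact (h1.clm_apply contDiffOn_const).congr fun y hy =>
    mvfderiv_chartFrame (hh.mdifferentiable (by simp)) p₀ hy v

/-- Forms of degree greater than the dimension vanish. -/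
theorem extDer_eq_zero_of_finrank_lt {E : Type*} [NormedAddCommGroup E] [NormedSpace ℝ E]
    [FiniteDimensional ℝ E] {H : Type*}
    [TopologicalSpace H] {I : ModelWithCorners ℝ E H} {M : Type*} [TopologicalSpace M]
    [ChartedSpace H M] {l : ℕ} (hl : Module.finrank ℝ E < l + 1) (σ : RawForm I M l) :
    extDer σ = 0 := by
  funext p
  apply ContinuousAlternatingMap.toAlternatingMap_injective
  ext w
  let A : E [⋀^Fin (l + 1)]→ₗ[ℝ] ℝ := (extDer σ p).toAlternatingMap
  refine A.map_linearDependent w fun h => ?_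
  have h1 := h.fintype_card_le_finrank
  rw [Fintype.card_fin] at h1
  omega

end Charts

/-! ### The angle form in coordinates -/

section Calculus
variable {E : Type*} [NormedAddCommGroup E] [NormedSpace ℝ E]

open ComplexConjugate

/-- The derivative of `Z dθ`, where `U = exp(i θ)` and `dθ = Im(Ū dU)`. The last term is symmetric
in `v` and `w`, so it cancels in the exterior derivative. -/
theorem fderiv_angle {Z : E → ℝ} {U : E → ℂ} {x : E} (hZ : DifferentiableAt ℝ Z x)
    (hU : ContDiffAt ℝ (⊤ : ℕ∞) U x) (hU1 : ∀ᶠ y in 𝓝 x, conj (U y) * U y = 1) (v w : E) :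
    fderiv ℝ (fun y => Z y * (conj (U y) * fderiv ℝ U y w).im) x v =
      fderiv ℝ Z x v * (conj (U x) * fderiv ℝ U x w).im +
        Z x * (conj (U x) * fderiv ℝ (fderiv ℝ U) x v w).im := by
  have hd : HasFDerivAt U (fderiv ℝ U x) x := (hU.differentiableAt (by simp)).hasFDerivAt
  have hdd : HasFDerivAt (fderiv ℝ U) (fderiv ℝ (fderiv ℝ U) x) x :=
    ((hU.fderiv_right (m := 1) (by norm_cast)).differentiableAt (by simp)).hasFDerivAt
  have hc : HasFDerivAt (fun y => conj (U y)) (Complex.conjCLE.toContinuousLinearMap.comp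
      (fderiv ℝ U x)) x := Complex.conjCLE.toContinuousLinearMap.hasFDerivAt.comp x hd
  -- Differentiating `|U|² = 1`: the derivatives of `U` are real multiples of `i U`.
  have hre : ∀ v, (conj (U x) * fderiv ℝ U x v).re = 0 := by
    intro v
    have h1 := (hc.mul hd).unique ((hasFDerivAt_const (1 : ℂ) x).congr_of_eventuallyEq hU1)
    have h2 := congrArg Complex.re (DFunLike.congr_fun h1 v)
    simp at h2
    simp
    linarith
  -- A product of two imaginary numbers is real.
  have him : (conj (fderiv ℝ U x v) * fderiv ℝ U x w).im = 0 := by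
    have h1 : conj (fderiv ℝ U x v) * fderiv ℝ U x w =
        conj (conj (U x) * fderiv ℝ U x v) * (conj (U x) * fderiv ℝ U x w) := by
      have := hU1.self_of_nhds
      simp only [map_mul, Complex.conj_conj]
      linear_combination -(conj (fderiv ℝ U x v) * fderiv ℝ U x w) * this
    rw [h1, Complex.mul_im, Complex.conj_re, Complex.conj_im, hre, hre]
    simp
  have hw : HasFDerivAt (fun y => fderiv ℝ U y w) ((fderiv ℝ (fderiv ℝ U) x).flip w) x :=
    (hdd.clm_apply (hasFDerivAt_const w x)).congr_fderiv (by ext; simp)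
  have h2 := hZ.hasFDerivAt.mul (Complex.imCLM.hasFDerivAt.comp x (hc.mul hw))
  have h3 : fderiv ℝ (fun y => Z y * (conj (U y) * fderiv ℝ U y w).im) x v = _ :=
    DFunLike.congr_fun h2.fderiv v
  rw [h3]
  have h4 : (conj (U x) * fderiv ℝ (fderiv ℝ U) x v w + conj (fderiv ℝ U x v) * fderiv ℝ U x w).im =
      (conj (U x) * fderiv ℝ (fderiv ℝ U) x v w).im := by
    rw [Complex.add_im, him, add_zero]
  rw [← h4]
  simp [-Complex.mul_im, -Complex.add_im]
  rw [Complex.add_im]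
  ring_nf

end Calculus

/-! ### Angle forms on `S¹ × S¹ × ℝ` -/

section AngleForms
open ComplexConjugate

theorem contMDiff_coe_circle : ContMDiff (𝓡 1) 𝓘(ℝ, ℂ) (⊤ : ℕ∞) (fun z : Circle => (z : ℂ)) :=
  haveI := finrank_real_complex_fact'
  (contMDiff_coe_sphere :
    ContMDiff (𝓡 1) 𝓘(ℝ, ℂ) (⊤ : ℕ∞) (Subtype.val : Metric.sphere (0 : ℂ) 1 → ℂ))

theorem contDiffOn_angleForm {u : TorusLine → Circle}
    (hu : ContMDiff torusLineModel (𝓡 1) (⊤ : ℕ∞) u) (p₀ : TorusLine) (v) :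
    ContDiffOn ℝ (⊤ : ℕ∞)
      (fun y => angleForm u ((extChartAt torusLineModel p₀).symm y) (chartFrame torusLineModel p₀ y v))
      (extChartAt torusLineModel p₀).target := by
  have h1 : ContMDiff torusLineModel 𝓘(ℝ, ℂ) (⊤ : ℕ∞) fun q => (u q : ℂ) :=
    contMDiff_coe_circle.comp hu
  have h2 := Complex.conjCLE.contDiff.comp_contDiffOn (contDiffOn_comp_extChartAt_symm h1 p₀)
  exact Complex.imCLM.contDiff.comp_contDiffOn (h2.mul (contDiffOn_covector_mvfderiv h1 p₀ v))

/-- The smooth `1`-form `g dθ`, where `u = exp(i θ)`. -/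
def angleOneForm (g : TorusLine → ℝ) (u : TorusLine → Circle)
    (hg : ContMDiff torusLineModel 𝓘(ℝ, ℝ) (⊤ : ℕ∞) g)
    (hu : ContMDiff torusLineModel (𝓡 1) (⊤ : ℕ∞) u) :
    SmoothForm torusLineModel TorusLine 1 :=
  ⟨fun p => ContinuousAlternatingMap.ofSubsingleton ℝ _ ℝ (0 : Fin 1) (g p • angleForm u p),
    isSmoothForm_iff.mpr fun p₀ v =>
      (contDiffOn_comp_extChartAt_symm hg p₀).mul (contDiffOn_angleForm hu p₀ (v 0))⟩

/-- `d(g dθ) = dg ∧ dθ`. -/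
theorem extDer_angleOneForm_apply (g : TorusLine → ℝ) (u : TorusLine → Circle)
    (hg : ContMDiff torusLineModel 𝓘(ℝ, ℝ) (⊤ : ℕ∞) g)
    (hu : ContMDiff torusLineModel (𝓡 1) (⊤ : ℕ∞) u) (p : TorusLine)
    (w : Fin 2 → TangentSpace torusLineModel p) :
    extDer (angleOneForm g u hg hu : RawForm torusLineModel TorusLine 1) p w =
      mvfderiv torusLineModel g p (w 0) * angleForm u p (w 1) -
        mvfderiv torusLineModel g p (w 1) * angleForm u p (w 0) := by
  have hu' : ContMDiff torusLineModel 𝓘(ℝ, ℂ) (⊤ : ℕ∞) fun q => (u q : ℂ) :=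
    contMDiff_coe_circle.comp hu
  have hnhds := extChartAt_target_mem_nhds (I := torusLineModel) p
  set x := extChartAt torusLineModel p p with hx
  set Z := g ∘ (extChartAt torusLineModel p).symm with hZ
  set U := (fun q => (u q : ℂ)) ∘ (extChartAt torusLineModel p).symm with hU
  have hZd : ContDiffAt ℝ (⊤ : ℕ∞) Z x :=
    (contDiffOn_comp_extChartAt_symm hg p).contDiffAt hnhds
  have hUd : ContDiffAt ℝ (⊤ : ℕ∞) U x :=
    (contDiffOn_comp_extChartAt_symm hu' p).contDiffAt hnhds
  have hU1 : ∀ᶠ y in 𝓝 x, conj (U y) * U y = 1 := .of_forall fun y => by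
    simp [hU, mul_comm, Complex.mul_conj]
  have hrep : ∀ v : Fin 1 → _, (fun y => chartRep
      (angleOneForm g u hg hu : RawForm torusLineModel TorusLine 1) p y v) =ᶠ[𝓝 x]
        fun y => Z y * (conj (U y) * fderiv ℝ U y (v 0)).im := by
    intro v
    filter_upwards [hnhds] with y hy
    rw [← mvfderiv_chartFrame (hu'.mdifferentiable (by simp)) p hy]
    rfl
  have hsymm : ∀ v v', fderiv ℝ (fderiv ℝ U) x v v' = fderiv ℝ (fderiv ℝ U) x v' v :=
    hUd.isSymmSndFDerivAt (by
      rw [minSmoothness_of_isRCLikeNormedField]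
      exact WithTop.coe_le_coe.mpr (le_top (a := (2 : ℕ∞))))
  have hangle : ∀ v, (conj (U x) * fderiv ℝ U x v).im = angleForm u p v := by
    intro v
    have h := mvfderiv_eq_fderiv_extChartAt (hu'.mdifferentiable (by simp) p) v
    have hp : U x = u p := congrArg (fun q => (u q : ℂ)) (extChartAt_to_inv (I := torusLineModel) p)
    rw [hp]
    exact congrArg (fun c : ℂ => (conj (u p : ℂ) * c).im) h.symm
  have hg' : ∀ v, fderiv ℝ Z x v = mvfderiv torusLineModel g p v := fun v =>
    (mvfderiv_eq_fderiv_extChartAt (hg.mdifferentiable (by simp) p) v).symm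
  have hder : ∀ (v : Fin 1 → _) (v'), fderiv ℝ (fun y => chartRep
      (angleOneForm g u hg hu : RawForm torusLineModel TorusLine 1) p y v) x v' =
        mvfderiv torusLineModel g p v' * angleForm u p (v 0) +
        Z x * (conj (U x) * fderiv ℝ (fderiv ℝ U) x v' (v 0)).im := by
    intro v v'
    rw [(hrep v).fderiv_eq, fderiv_angle (hZd.differentiableAt (by simp)) hUd hU1]
    exact congrArg₂ (fun a b => a * b + _) (hg' _) (hangle _)
  refine (extDer_apply (angleOneForm g u hg hu).2 p w).trans ((Fin.sum_univ_two _).trans ?_)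
  rw [Fin.val_zero, Fin.val_one, pow_zero, pow_one, one_smul, neg_smul, one_smul]
  refine (congrArg₂ (fun a b => a + -b) (hder _ (w 0)) (hder _ (w 1))).trans ?_
  rw [hsymm (w 1)]
  exact (by intros; ring : ∀ a b c d e : ℝ, (a * b + e) + -(c * d + e) = a * b - c * d) _ _ _ _ _

theorem isSmoothForm_torusVolume : IsSmoothForm torusVolume := by
  refine isSmoothForm_iff.mpr fun p₀ v => ?_
  simp only [torusVolume, wedge_apply, Matrix.det_fin_three, Matrix.of_apply]
  have h1 := contDiffOn_angleForm contMDiff_fst p₀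
  have h2 := contDiffOn_angleForm (contMDiff_fst.comp contMDiff_snd) p₀
  have h3 := contDiffOn_covector_mvfderiv (contMDiff_snd.comp contMDiff_snd :
    ContMDiff torusLineModel 𝓘(ℝ, ℝ) (⊤ : ℕ∞) _) p₀
  exact ((((((h1 (v 0)).mul (h2 (v 1))).mul (h3 (v 2))).sub
    (((h1 (v 0)).mul (h2 (v 2))).mul (h3 (v 1)))).sub
    (((h1 (v 1)).mul (h2 (v 0))).mul (h3 (v 2)))).add
    (((h1 (v 1)).mul (h2 (v 2))).mul (h3 (v 0)))).add
    (((h1 (v 2)).mul (h2 (v 0))).mul (h3 (v 1))) |>.sub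
    (((h1 (v 2)).mul (h2 (v 1))).mul (h3 (v 0)))

/-- The form `dθ` is invariant under a diffeomorphism that multiplies `exp(i θ)` by a constant. -/
theorem angleForm_smul_mfderiv {u : TorusLine → Circle}
    (hu : ContMDiff torusLineModel (𝓡 1) (⊤ : ℕ∞) u) (g : Torus) (c : Circle)
    (hc : ∀ p, u (g • p) = c * u p) (p : TorusLine) (v : TangentSpace torusLineModel p) :
    angleForm u (g • p) (mfderiv torusLineModel torusLineModel (fun q : TorusLine => g • q) p v) =
      angleForm u p v := by
  have hu' : ContMDiff torusLineModel 𝓘(ℝ, ℂ) (⊤ : ℕ∞) fun q => (u q : ℂ) :=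
    contMDiff_coe_circle.comp hu
  have hsm : ContMDiff torusLineModel torusLineModel (⊤ : ℕ∞) (fun q : TorusLine => g • q) :=
    (contMDiff_const : ContMDiff torusLineModel torusModel (⊤ : ℕ∞) fun _ => g).smul contMDiff_id
  have h1 := mfderiv_comp_apply p ((hu'.mdifferentiable (by simp)) (g • p))
    (hsm.mdifferentiable (by simp) p) v
  have h2 : (fun q => (u q : ℂ)) ∘ (fun q : TorusLine => g • q) =
      fun q => ContinuousLinearMap.mul ℝ ℂ (c : ℂ) (u q) := by
    funext q
    simp [hc]
  rw [h2] at h1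
  have h3 := mvfderiv_clm_comp (ContinuousLinearMap.mul ℝ ℂ (c : ℂ))
    (hu'.mdifferentiable (by simp) p) v
  have h4 : mvfderiv torusLineModel (fun q => (u q : ℂ)) (g • p)
      (mfderiv torusLineModel torusLineModel (fun q : TorusLine => g • q) p v) =
        c * mvfderiv torusLineModel (fun q => (u q : ℂ)) p v := h1.symm.trans h3
  have h5 : conj (u (g • p) : ℂ) * (c * mvfderiv torusLineModel (fun q => (u q : ℂ)) p v) =
      conj (u p : ℂ) * mvfderiv torusLineModel (fun q => (u q : ℂ)) p v := by
    have h6 : conj (c : ℂ) * c = 1 := by rw [mul_comm, Complex.mul_conj]; simp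
    rw [hc, Circle.coe_mul, map_mul]
    linear_combination conj (u p : ℂ) * mvfderiv torusLineModel (fun q => (u q : ℂ)) p v * h6
  exact (congrArg (fun z : ℂ => (conj (u (g • p) : ℂ) * z).im) h4).trans (congrArg Complex.im h5)

/-- The differential at `1` of a circle-valued function `χ` on the torus with `χ 1 = 1`, where the
Lie algebra of the circle is identified with `ℝ` by `t ↦ i t`. -/
def angleFunctional (χ : Torus → Circle) : GroupLieAlgebra torusModel Torus →ₗ[ℝ] ℝ :=
  Complex.imCLM.toLinearMap ∘ₗ (mvfderiv torusModel (fun g => (χ g : ℂ)) 1).toLinearMap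

theorem angleForm_generator {u : TorusLine → Circle} {χ : Torus → Circle}
    (hu : ContMDiff torusLineModel (𝓡 1) (⊤ : ℕ∞) u)
    (hχ : ContMDiff torusModel (𝓡 1) (⊤ : ℕ∞) χ)
    (hc : ∀ g p, u (g • p) = χ g * u p) (x : GroupLieAlgebra torusModel Torus) (p : TorusLine) :
    angleForm u p (generator x p) = -angleFunctional χ x := by
  have hu' : ContMDiff torusLineModel 𝓘(ℝ, ℂ) (⊤ : ℕ∞) fun q => (u q : ℂ) :=
    contMDiff_coe_circle.comp hu
  have hχ' : ContMDiff torusModel 𝓘(ℝ, ℂ) (⊤ : ℕ∞) fun q => (χ q : ℂ) :=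
    contMDiff_coe_circle.comp hχ
  have hsm : ContMDiff torusModel torusLineModel (⊤ : ℕ∞) (fun g : Torus => g • p) :=
    contMDiff_id.smul contMDiff_const
  have h1 := mfderiv_comp_apply_of_eq (1 : Torus) ((hu'.mdifferentiable (by simp)) p)
    (hsm.mdifferentiable (by simp) 1) (one_smul _ p) x
  have h2 : (fun q => (u q : ℂ)) ∘ (fun g : Torus => g • p) =
      fun g => ContinuousLinearMap.mul ℝ ℂ (u p : ℂ) (χ g) := by
    funext q
    simp [hc, mul_comm]
  rw [h2] at h1
  have h3 := mvfderiv_clm_comp (ContinuousLinearMap.mul ℝ ℂ (u p : ℂ))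
    (hχ'.mdifferentiable (by simp) 1) x
  have h4 : mvfderiv torusLineModel (fun q => (u q : ℂ)) p
      (mfderiv torusModel torusLineModel (fun g : Torus => g • p) 1 x) =
        u p * mvfderiv torusModel (fun q => (χ q : ℂ)) 1 x := h1.symm.trans h3
  have h5 : conj (u p : ℂ) * (u p * mvfderiv torusModel (fun q => (χ q : ℂ)) 1 x) =
      mvfderiv torusModel (fun q => (χ q : ℂ)) 1 x := by
    have h6 : conj (u p : ℂ) * u p = 1 := by rw [mul_comm, Complex.mul_conj]; simp
    rw [← mul_assoc, h6, one_mul]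
  refine (map_neg (angleForm u p) _).trans (congrArg Neg.neg ?_)
  exact (congrArg (fun z : ℂ => (conj (u p : ℂ) * z).im) h4).trans (congrArg Complex.im h5)

end AngleForms

/-! ### The Lie algebra of a commutative Lie group -/

section Commutative
open VectorField

variable {E H G : Type*} [NormedAddCommGroup E] [NormedSpace ℝ E]
    [TopologicalSpace H] {I : ModelWithCorners ℝ E H} [TopologicalSpace G]
    [ChartedSpace H G] [CommGroup G] [LieGroup I (minSmoothness ℝ 3) G]

theorem minSmoothness_real_three_ne_zero : minSmoothness ℝ 3 ≠ 0 := by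
  rw [minSmoothness_of_isRCLikeNormedField]; norm_num

theorem mdifferentiable_inv_group : MDifferentiable I I fun g : G => g⁻¹ :=
  (contMDiff_inv I (minSmoothness ℝ 3)).mdifferentiable minSmoothness_real_three_ne_zero

/-- This follows from differentiating `g * g⁻¹ = 1`. -/
theorem mfderiv_inv_one_apply (v : GroupLieAlgebra I G) :
    (mfderiv I I (fun g : G => g⁻¹) 1 : E →L[ℝ] E) v = -v := by
  have hmul : MDifferentiable (I.prod I) I fun q : G × G => q.1 * q.2 :=
    (contMDiff_mul I (minSmoothness ℝ 3)).mdifferentiable minSmoothness_real_three_ne_zero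
  have hinv : MDifferentiableAt I I (fun g : G => g⁻¹) 1 := mdifferentiable_inv_group 1
  have hr : (fun x : G => x * 1) = id := funext mul_one
  have hl : (fun x : G => 1 * x) = id := funext one_mul
  have hadd : ∀ a b : E, (mfderiv (I.prod I) I (fun q : G × G => q.1 * q.2) (1, 1) :
      E × E →L[ℝ] E) (a, b) = a + b := by
    intro a b
    refine (mfderiv_prod_eq_add_apply (v := (a, b)) (hmul ((1 : G), (1 : G)))).trans ?_
    rw [hr, hl, mfderiv_id]
    rfl
  have h1 := mfderiv_comp_apply_of_eq (1 : G) (hmul ((1 : G), (1 : G)))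
    (mdifferentiableAt_id.prodMk hinv) (by simp) v
  have h2 : (fun q : G × G => q.1 * q.2) ∘ (fun g : G => (id g, g⁻¹)) = fun _ => 1 := by
    funext g
    simp
  rw [h2, mfderiv_const, mfderiv_prodMk mdifferentiableAt_id hinv, mfderiv_id] at h1
  exact eq_neg_of_add_eq_zero_right (h1.trans (hadd v _)).symm

/-- Inversion in a Lie group as a diffeomorphism. -/
def invDiffeomorph : G ≃ₘ^(minSmoothness ℝ 3)⟮I, I⟯ G where
  toEquiv := Equiv.inv G
  contMDiff_toFun := contMDiff_inv I _
  contMDiff_invFun := contMDiff_inv I _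

theorem mpullback_inv_mulInvariantVectorField (x : GroupLieAlgebra I G) :
    mpullback I I (fun g : G => g⁻¹) (mulInvariantVectorField x) =
      mulInvariantVectorField (-x) := by
  funext g
  have h0 : (mfderiv I I (fun g : G => g⁻¹) g).IsInvertible :=
    ⟨invDiffeomorph.mfderivToContinuousLinearEquiv minSmoothness_real_three_ne_zero g, rfl⟩
  rw [mpullback, h0.inverse_apply_eq]
  have hL : ∀ a : G, MDifferentiable I I fun b : G => a * b := fun a =>
    (contMDiff_mul_left (n := minSmoothness ℝ 3)).mdifferentiable minSmoothness_real_three_ne_zero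
  have h1 := mfderiv_comp_apply_of_eq (1 : G) (mdifferentiable_inv_group (I := I) g) (hL g 1)
    (mul_one g) (-x)
  have h2 := mfderiv_comp_apply_of_eq (1 : G) (hL g⁻¹ 1) (mdifferentiable_inv_group (I := I) 1)
    inv_one (-x)
  have h3 : (fun g : G => g⁻¹) ∘ (fun b => g * b) = (fun b => g⁻¹ * b) ∘ (fun g : G => g⁻¹) := by
    funext b
    simp [mul_comm]
  rw [h3] at h1
  have h4 : (mfderiv I I (fun g : G => g⁻¹) 1 : E →L[ℝ] E) (-x) = x :=
    (mfderiv_inv_one_apply (-x)).trans (neg_neg x)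
  refine Eq.trans ?_ (h2.symm.trans h1)
  exact congrArg (mfderiv I I (fun b => g⁻¹ * b) 1 : E →L[ℝ] E) h4.symm

/-- Pulling back along inversion preserves brackets and sends the invariant field of `x` to that of
`-x`, so `-⁅x, y⁆ = ⁅-x, -y⁆ = ⁅x, y⁆`. -/
theorem bracket_eq_zero_of_comm [CompleteSpace E]
    (x y : GroupLieAlgebra I G) : ⁅x, y⁆ = 0 := by
  have h1 := mpullback_mlieBracket (n := minSmoothness ℝ 3) (x₀ := (1 : G))
    (mdifferentiableAt_mulInvariantVectorField x)
    (mdifferentiableAt_mulInvariantVectorField y)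
    (contMDiff_inv I (minSmoothness ℝ 3)).contMDiffAt (minSmoothness_monotone (by norm_cast))
  rw [← mulInvariantVector_mlieBracket] at h1
  simp only [mpullback_inv_mulInvariantVectorField] at h1
  rw [← GroupLieAlgebra.bracket_def, ← GroupLieAlgebra.bracket_def, neg_lie, lie_neg, neg_neg] at h1
  have h2 : ∀ z : GroupLieAlgebra I G, mulInvariantVectorField z 1 = z := fun z => by
    have hid : (fun x : G => 1 * x) = id := by funext; simp
    rw [mulInvariantVectorField, hid, mfderiv_id]
    rfl
  rw [h2] at h1
  have : IsAddTorsionFree (GroupLieAlgebra I G) := .of_isTorsionFree ℝ E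
  exact self_eq_neg.mp h1.symm

end Commutative

section Cochains
variable {E H G : Type*} [NormedAddCommGroup E] [NormedSpace ℝ E]
    [TopologicalSpace H] {J : ModelWithCorners ℝ E H} [TopologicalSpace G]
    [ChartedSpace H G] [CommGroup G]
    {E' H' M : Type*} [NormedAddCommGroup E'] [NormedSpace ℝ E']
    [TopologicalSpace H'] {I : ModelWithCorners ℝ E' H'} [TopologicalSpace M]
    [ChartedSpace H' M]

theorem ceDifferential_eq_zero_of_comm [CompleteSpace E] [LieGroup J (minSmoothness ℝ 3) G]
    {k l : ℕ} (F : Cochain J G I M (k + 1) l)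
    (x : Fin (k + 2) → GroupLieAlgebra J G) : ceDifferential F x = 0 := by
  refine Finset.sum_eq_zero fun j _ => Finset.sum_eq_zero fun i _ => ?_
  split_ifs with h
  · rw [bracket_eq_zero_of_comm, F.map_coord_zero 0 (Fin.cons_zero _ _), smul_zero]
  · rfl

theorem adjoint_of_comm (g : G) (x : GroupLieAlgebra J G) : adjoint g x = x := by
  have h : (fun h : G => g * h * g⁻¹) = id := by funext h; simp
  rw [adjoint, h, mfderiv_id]
  rfl

end Cochains

/-! ### An equivariant moment map for `dθ₁ ∧ dθ₂ ∧ dz` -/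

section TorusExample

/-- The Lie algebra of the torus. -/
abbrev torusAlgebra : Type := GroupLieAlgebra torusModel Torus

theorem contMDiff_circle₁ : ContMDiff torusLineModel (𝓡 1) (⊤ : ℕ∞) fun q : TorusLine => q.1 :=
  contMDiff_fst

theorem contMDiff_circle₂ : ContMDiff torusLineModel (𝓡 1) (⊤ : ℕ∞) fun q : TorusLine => q.2.1 :=
  contMDiff_fst.comp contMDiff_snd

theorem contMDiff_height : ContMDiff torusLineModel 𝓘(ℝ, ℝ) (⊤ : ℕ∞) fun q : TorusLine => q.2.2 :=
  contMDiff_snd.comp contMDiff_snd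

/-- The first coordinate on the Lie algebra of the torus. -/
def coord₁ : torusAlgebra →ₗ[ℝ] ℝ := angleFunctional fun g => g.1

/-- The second coordinate on the Lie algebra of the torus. -/
def coord₂ : torusAlgebra →ₗ[ℝ] ℝ := angleFunctional fun g => g.2

/-- The `1`-form `dθ₁`. -/
def dθ₁ (p : TorusLine) : TangentSpace torusLineModel p →L[ℝ] ℝ := angleForm (fun q => q.1) p

/-- The `1`-form `dθ₂`. -/
def dθ₂ (p : TorusLine) : TangentSpace torusLineModel p →L[ℝ] ℝ := angleForm (fun q => q.2.1) p

theorem dθ₁_generator (x : torusAlgebra) (p : TorusLine) : dθ₁ p (generator x p) = -coord₁ x :=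
  angleForm_generator contMDiff_circle₁ contMDiff_fst (fun _ _ => rfl) x p

theorem dθ₂_generator (x : torusAlgebra) (p : TorusLine) : dθ₂ p (generator x p) = -coord₂ x :=
  angleForm_generator contMDiff_circle₂ contMDiff_snd (fun _ _ => rfl) x p

theorem dz_generator (x : torusAlgebra) (p : TorusLine) : dz p (generator x p) = 0 := by
  have hsm : ContMDiff torusModel torusLineModel (⊤ : ℕ∞) (fun g : Torus => g • p) :=
    contMDiff_id.smul contMDiff_const
  have h1 := mfderiv_comp_apply_of_eq (1 : Torus) ((contMDiff_height.mdifferentiable (by simp)) p)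
    (hsm.mdifferentiable (by simp) 1) (one_smul _ p) x
  have h2 : (fun q : TorusLine => q.2.2) ∘ (fun g : Torus => g • p) = fun _ => p.2.2 := rfl
  rw [h2, mfderiv_const] at h1
  refine (map_neg (dz p) _).trans (neg_eq_zero.mpr ?_)
  exact h1.symm

theorem dθ₁_smul (g : Torus) (p : TorusLine) (v : TangentSpace torusLineModel p) :
    dθ₁ (g • p) (mfderiv torusLineModel torusLineModel (fun q : TorusLine => g • q) p v) = dθ₁ p v :=
  angleForm_smul_mfderiv contMDiff_circle₁ g g.1 (fun _ => rfl) p v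

theorem dθ₂_smul (g : Torus) (p : TorusLine) (v : TangentSpace torusLineModel p) :
    dθ₂ (g • p) (mfderiv torusLineModel torusLineModel (fun q : TorusLine => g • q) p v) = dθ₂ p v :=
  angleForm_smul_mfderiv contMDiff_circle₂ g g.2 (fun _ => rfl) p v

theorem dz_smul (g : Torus) (p : TorusLine) (v : TangentSpace torusLineModel p) :
    dz (g • p) (mfderiv torusLineModel torusLineModel (fun q : TorusLine => g • q) p v) = dz p v := by
  have hsm : ContMDiff torusLineModel torusLineModel (⊤ : ℕ∞) (fun q : TorusLine => g • q) :=
    (contMDiff_const : ContMDiff torusLineModel torusModel (⊤ : ℕ∞) fun _ => g).smul contMDiff_id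
  exact (mfderiv_comp_apply p ((contMDiff_height.mdifferentiable (by simp)) (g • p))
    (hsm.mdifferentiable (by simp) p) v).symm

/-- The form `dθ₁ ∧ dθ₂ ∧ dz` as a smooth form. -/
def torusVolumeForm : SmoothForm torusLineModel TorusLine 3 :=
  ⟨torusVolume, isSmoothForm_torusVolume⟩

theorem torusVolume_apply (p : TorusLine) (w : Fin 3 → TangentSpace torusLineModel p) :
    torusVolume p w =
      dθ₁ p (w 0) * dθ₂ p (w 1) * dz p (w 2) - dθ₁ p (w 0) * dθ₂ p (w 2) * dz p (w 1)
      - dθ₁ p (w 1) * dθ₂ p (w 0) * dz p (w 2) + dθ₁ p (w 1) * dθ₂ p (w 2) * dz p (w 0)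
      + dθ₁ p (w 2) * dθ₂ p (w 0) * dz p (w 1) - dθ₁ p (w 2) * dθ₂ p (w 1) * dz p (w 0) := by
  rw [torusVolume, wedge_apply, Matrix.det_fin_three]
  rfl

theorem isInvariant_torusVolume : IsInvariant Torus torusVolume := by
  intro g
  funext p
  ext w
  change torusVolume (g • p) (fun i => mfderiv torusLineModel torusLineModel
    (fun q : TorusLine => g • q) p (w i)) = _
  simp only [torusVolume_apply, dθ₁_smul, dθ₂_smul, dz_smul]

/-- The component `f₁(x) = x₁ (dθ₁ - z dθ₂) + x₂ z dθ₁`. -/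
def moment₁ : torusAlgebra →ₗ[ℝ] SmoothForm torusLineModel TorusLine 1 :=
  coord₁.smulRight (angleOneForm (fun _ => 1) _ contMDiff_const contMDiff_circle₁ -
    angleOneForm _ _ contMDiff_height contMDiff_circle₂) +
  coord₂.smulRight (angleOneForm _ _ contMDiff_height contMDiff_circle₁)

theorem moment₁_apply (x : torusAlgebra) (p : TorusLine)
    (w : Fin 1 → TangentSpace torusLineModel p) :
    (moment₁ x : RawForm torusLineModel TorusLine 1) p w =
      coord₁ x * (1 * dθ₁ p (w 0) - p.2.2 * dθ₂ p (w 0)) + coord₂ x * (p.2.2 * dθ₁ p (w 0)) := rfl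

theorem extDer_moment₁_apply (x : torusAlgebra) (p : TorusLine)
    (w : Fin 2 → TangentSpace torusLineModel p) :
    extDer (moment₁ x : RawForm torusLineModel TorusLine 1) p w =
      coord₂ x * (dz p (w 0) * dθ₁ p (w 1) - dz p (w 1) * dθ₁ p (w 0)) -
      coord₁ x * (dz p (w 0) * dθ₂ p (w 1) - dz p (w 1) * dθ₂ p (w 0)) := by
  have h1 : extDer (moment₁ x : RawForm torusLineModel TorusLine 1) =
     coord₁ x • (extDer (angleOneForm (fun _ => 1) _ contMDiff_const contMDiff_circle₁ :
       RawForm torusLineModel TorusLine 1) -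
     extDer (angleOneForm _ _ contMDiff_height contMDiff_circle₂ :
       RawForm torusLineModel TorusLine 1)) + coord₂ x • extDer
    (angleOneForm _ _ contMDiff_height contMDiff_circle₁ : RawForm torusLineModel TorusLine 1) := by
    change extDerₗ torusLineModel TorusLine 1 (moment₁ x) = _
    simp only [moment₁, LinearMap.add_apply, LinearMap.smulRight_apply, map_add, map_smul]
    exact congrArg (fun a => coord₁ x • a + _) (map_sub (extDerₗ torusLineModel TorusLine 1) _ _)
  rw [h1]
  refine (congrArg₂ (fun a b => coord₁ x * a + coord₂ x * b)
    (congrArg₂ (fun a b => a - b) (extDer_angleOneForm_apply _ _ _ _ p w)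
      (extDer_angleOneForm_apply _ _ _ _ p w)) (extDer_angleOneForm_apply _ _ _ _ p w)).trans ?_
  rw [mvfderiv_const]
  change coord₁ x * ((0 * dθ₁ p (w 1) - 0 * dθ₁ p (w 0)) -
    (dz p (w 0) * dθ₂ p (w 1) - dz p (w 1) * dθ₂ p (w 0))) +
    coord₂ x * (dz p (w 0) * dθ₁ p (w 1) - dz p (w 1) * dθ₁ p (w 0)) = _
  ring

/-- The function `z` as a `0`-form. -/
def heightForm : SmoothForm torusLineModel TorusLine 0 :=
  ⟨fun p => ContinuousAlternatingMap.constOfIsEmpty ℝ _ (Fin 0) p.2.2,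
    isSmoothForm_iff.mpr fun p₀ _ => contDiffOn_comp_extChartAt_symm contMDiff_height p₀⟩

/-- The component `f₂(x, y) = (x₂ y₁ - x₁ y₂) z`. The order of the two coordinates in the determinant
accounts for the sign. -/
def moment₂ : torusAlgebra [⋀^Fin 2]→ₗ[ℝ] SmoothForm torusLineModel TorusLine 0 :=
  (LinearMap.toSpanSingleton ℝ _ heightForm).compAlternatingMap
    (Matrix.detRowAlternating.compLinearMap (LinearMap.pi ![coord₂, coord₁]))

theorem moment₂_apply (x : Fin 2 → torusAlgebra) :
    moment₂ x = (coord₁ (x 1) * coord₂ (x 0) - coord₁ (x 0) * coord₂ (x 1)) • heightForm := by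
  have h : (Matrix.of fun i j => (![coord₂, coord₁] j) (x i) : Matrix (Fin 2) (Fin 2) ℝ).det =
      coord₁ (x 1) * coord₂ (x 0) - coord₁ (x 0) * coord₂ (x 1) := by
    rw [Matrix.det_fin_two]
    change coord₂ (x 0) * coord₁ (x 1) - coord₁ (x 0) * coord₂ (x 1) = _
    ring
  exact congrArg (· • heightForm) h

theorem extDer_moment₂_apply (x : Fin 2 → torusAlgebra) (p : TorusLine)
    (w : Fin 1 → TangentSpace torusLineModel p) :
    extDer (moment₂ x : RawForm torusLineModel TorusLine 0) p w =
      (coord₁ (x 1) * coord₂ (x 0) - coord₁ (x 0) * coord₂ (x 1)) * dz p (w 0) := by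
  have h1 : extDer (moment₂ x : RawForm torusLineModel TorusLine 0) =
      (coord₁ (x 1) * coord₂ (x 0) - coord₁ (x 0) * coord₂ (x 1)) •
        extDer (heightForm : RawForm torusLineModel TorusLine 0) := by
    rw [moment₂_apply]
    exact map_smul (extDerₗ torusLineModel TorusLine 0) _ _
  rw [h1]
  exact congrArg (_ * ·) (extDer_zeroForm_apply heightForm.2 p w)

/-- The homotopy moment map with components `moment₁` and `moment₂`. -/
def torusMoment : TotalCochain torusModel Torus torusLineModel TorusLine 2
  | 0, 1, _ => AlternatingMap.ofSubsingleton ℝ _ _ (0 : Fin 1) moment₁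
  | 1, 0, _ => moment₂
  | 0, 0, h => absurd h (by decide)
  | 0, _ + 2, h => absurd h (by omega)
  | 1, _ + 1, h => absurd h (by omega)
  | _ + 2, _, h => absurd h (by omega)

theorem isMomentMap_torusMoment : IsMomentMap torusVolume torusMoment where
  hamiltonian l h x := by
    obtain rfl : l = 1 := by omega
    funext p
    ext w
    have h1 := extDer_moment₁_apply x p w
    have h2 := torusVolume_apply p (Fin.cons (generator x p) w)
    change extDer (moment₁ x : RawForm torusLineModel TorusLine 1) p w =
      -torusVolume p (Fin.cons (generator x p) w)
    rw [h1, h2]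
    change _ = -(dθ₁ p (generator x p) * dθ₂ p (w 0) * dz p (w 1)
      - dθ₁ p (generator x p) * dθ₂ p (w 1) * dz p (w 0)
      - dθ₁ p (w 0) * dθ₂ p (generator x p) * dz p (w 1)
      + dθ₁ p (w 0) * dθ₂ p (w 1) * dz p (generator x p)
      + dθ₁ p (w 1) * dθ₂ p (generator x p) * dz p (w 0)
      - dθ₁ p (w 1) * dθ₂ p (w 0) * dz p (generator x p))
    rw [dθ₁_generator, dθ₂_generator, dz_generator]
    ring
  bracket j l h x := by
    obtain rfl : j = 0 := by omega
    obtain rfl : l = 0 := by omega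
    rw [ceDifferential_eq_zero_of_comm]
    funext p
    ext w
    have h1 := extDer_moment₂_apply x p w
    have h2 := torusVolume_apply p
      (Fin.cons (generator (x 0) p) (Fin.cons (generator (x 1) p) w : Fin 2 → _))
    have hs : varsigma (0 + 2) = 1 := by norm_num [varsigma]
    rw [hs]
    change -(0 : ℝ) = extDer (moment₂ x : RawForm torusLineModel TorusLine 0) p w + 1 * torusVolume p
      (Fin.cons (generator (x 0) p) (Fin.cons (generator (x 1) p) w : Fin 2 → _))
    rw [h1, h2]
    change _ = _ + 1 * (dθ₁ p (generator (x 0) p) * dθ₂ p (generator (x 1) p) * dz p (w 0)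
      - dθ₁ p (generator (x 0) p) * dθ₂ p (w 0) * dz p (generator (x 1) p)
      - dθ₁ p (generator (x 1) p) * dθ₂ p (generator (x 0) p) * dz p (w 0)
      + dθ₁ p (generator (x 1) p) * dθ₂ p (w 0) * dz p (generator (x 0) p)
      + dθ₁ p (w 0) * dθ₂ p (generator (x 0) p) * dz p (generator (x 1) p)
      - dθ₁ p (w 0) * dθ₂ p (generator (x 1) p) * dz p (generator (x 0) p))
    simp only [dθ₁_generator, dθ₂_generator, dz_generator]
    ring
  top j h x := by
    obtain rfl : j = 1 := by omega
    rw [ceDifferential_eq_zero_of_comm]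
    funext p
    ext w
    have h2 := torusVolume_apply p
      ![generator (x 0) p, generator (x 1) p, generator (x 2) p]
    have h3 : torusVolume p ![generator (x 0) p, generator (x 1) p, generator (x 2) p] = 0 := by
      rw [h2]
      change dθ₁ p (generator (x 0) p) * dθ₂ p (generator (x 1) p) * dz p (generator (x 2) p)
        - dθ₁ p (generator (x 0) p) * dθ₂ p (generator (x 2) p) * dz p (generator (x 1) p)
        - dθ₁ p (generator (x 1) p) * dθ₂ p (generator (x 0) p) * dz p (generator (x 2) p)
        + dθ₁ p (generator (x 1) p) * dθ₂ p (generator (x 2) p) * dz p (generator (x 0) p)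
        + dθ₁ p (generator (x 2) p) * dθ₂ p (generator (x 0) p) * dz p (generator (x 1) p)
        - dθ₁ p (generator (x 2) p) * dθ₂ p (generator (x 1) p) * dz p (generator (x 0) p) = 0
      simp only [dz_generator]
      ring
    change -(0 : ℝ) = varsigma (1 + 2) * torusVolume p (Fin.cons (generator (x 0) p)
      (Fin.cons (generator (x 1) p) (Fin.cons (generator (x 2) p) w : Fin 1 → _) : Fin 2 → _))
    rw [neg_zero, eq_comm, mul_eq_zero]
    right
    refine Eq.trans (congrArg (torusVolume p) ?_) h3
    funext i
    fin_cases i <;> rfl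

theorem isEquivariant_torusMoment : IsEquivariant torusMoment := by
  intro k l h g x
  simp only [adjoint_of_comm]
  obtain ⟨rfl, rfl⟩ | ⟨rfl, rfl⟩ : (k = 0 ∧ l = 1) ∨ (k = 1 ∧ l = 0) := by omega
  · funext p
    ext w
    change (moment₁ (x 0) : RawForm torusLineModel TorusLine 1) p w =
      (moment₁ (x 0) : RawForm torusLineModel TorusLine 1) (g⁻¹ • p)
        (fun i => mfderiv torusLineModel torusLineModel (fun q : TorusLine => g⁻¹ • q) p (w i))
    rw [moment₁_apply, moment₁_apply, dθ₁_smul, dθ₂_smul]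
    rfl
  · funext p
    ext w
    change (moment₂ x : RawForm torusLineModel TorusLine 0) p w =
      (moment₂ x : RawForm torusLineModel TorusLine 0) (g⁻¹ • p) _
    rw [moment₂_apply]
    rfl

end TorusExample

/-! ### The obstruction -/

section Obstruction

/-- The one-parameter subgroup `t ↦ (exp (i t), 1)`. -/
def firstCircle (t : ℝ) : Torus := (Circle.exp t, 1)

theorem contMDiff_firstCircle : ContMDiff 𝓘(ℝ, ℝ) torusModel (⊤ : ℕ∞) firstCircle :=
  contMDiff_circleExp.prodMk contMDiff_const

theorem firstCircle_zero : firstCircle 0 = 1 := by simp [firstCircle]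

/-- The velocity `e₁` of `t ↦ (exp (i t), 1)` at `t = 0`. -/
def basis₁ : torusAlgebra :=
  (mfderiv 𝓘(ℝ, ℝ) torusModel firstCircle 0 :
    ℝ →L[ℝ] EuclideanSpace ℝ (Fin 1) × EuclideanSpace ℝ (Fin 1)) 1

theorem hasDerivAt_comp_firstCircle {F : Type*} [NormedAddCommGroup F] [NormedSpace ℝ F]
    {h : Torus → F} (hh : MDifferentiable torusModel 𝓘(ℝ, F) h) :
    HasDerivAt (fun t => h (firstCircle t)) (mvfderiv torusModel h 1 basis₁) 0 := by
  have hc : MDifferentiableAt 𝓘(ℝ, ℝ) torusModel firstCircle 0 :=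
    contMDiff_firstCircle.mdifferentiable (by simp) 0
  have hd : DifferentiableAt ℝ (fun t => h (firstCircle t)) 0 :=
    ((hh _).comp 0 hc).differentiableAt
  have h1 := mfderiv_comp_apply_of_eq (0 : ℝ) (hh 1) hc firstCircle_zero (1 : ℝ)
  rw [mfderiv_eq_fderiv] at h1
  have h2 : deriv (fun t => h (firstCircle t)) 0 = mvfderiv torusModel h 1 basis₁ :=
    fderiv_apply_one_eq_deriv.symm.trans h1
  rw [← h2]
  exact hd.hasDerivAt

theorem coord₁_basis₁ : coord₁ basis₁ = 1 := by
  have h := hasDerivAt_comp_firstCircle (h := fun g : Torus => (g.1 : ℂ))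
    ((contMDiff_coe_circle.comp contMDiff_fst).mdifferentiable (n := (⊤ : ℕ∞)) (by simp))
  have h2 : HasDerivAt (fun t : ℝ => ((firstCircle t).1 : ℂ)) Complex.I 0 := by
    have h3 := ((Complex.ofRealCLM.hasDerivAt (x := (0:ℝ))).mul_const Complex.I).cexp
    simpa [firstCircle] using h3
  exact congrArg Complex.im (h.unique h2)

theorem coord₂_basis₁ : coord₂ basis₁ = 0 := by
  have h := hasDerivAt_comp_firstCircle (h := fun g : Torus => (g.2 : ℂ))
    ((contMDiff_coe_circle.comp contMDiff_snd).mdifferentiable (n := (⊤ : ℕ∞)) (by simp))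
  exact congrArg Complex.im (h.unique (hasDerivAt_const (0 : ℝ) (1 : ℂ)))

/-- A function has a maximum on the circle `S¹ × {1} × {0}`, which is an orbit of `e₁`. -/
theorem exists_mvfderiv_generator_basis₁_eq_zero {e : TorusLine → ℝ}
    (he : MDifferentiable torusLineModel 𝓘(ℝ, ℝ) e) :
    ∃ p, mvfderiv torusLineModel e p (generator basis₁ p) = 0 := by
  obtain ⟨u, -, hu⟩ := isCompact_univ.exists_isMaxOn (f := fun u : Circle => e (u, 1, 0))
    univ_nonempty (he.continuous.comp (by fun_prop)).continuousOn
  set p : TorusLine := (u, 1, 0)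
  refine ⟨p, ?_⟩
  have hsm : ContMDiff torusModel torusLineModel (⊤ : ℕ∞) (fun g : Torus => g • p) :=
    contMDiff_id.smul contMDiff_const
  have h1 := hasDerivAt_comp_firstCircle (h := fun g => e (g • p))
    (he.comp (hsm.mdifferentiable (by simp)))
  have hmax : IsLocalMax (fun t => e (firstCircle t • p)) 0 := by
    refine Filter.Eventually.of_forall fun t => ?_
    change e (firstCircle t • p) ≤ e (firstCircle 0 • p)
    rw [firstCircle_zero, one_smul]
    have h2 : firstCircle t • p = (Circle.exp t * u, 1, 0) :=
      Prod.ext rfl (Prod.ext (one_mul _) rfl)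
    rw [h2]
    exact hu (mem_univ (Circle.exp t * u))
  have h3 := hmax.hasDerivAt_eq_zero h1
  have h4 := mfderiv_comp_apply_of_eq (1 : Torus) (he p)
    (hsm.mdifferentiable (by simp) 1) (one_smul _ p) basis₁
  refine (map_neg (mvfderiv torusLineModel e p) _).trans (neg_eq_zero.mpr ?_)
  exact h4.symm.trans h3

/-- The component of degree `0` of the cocycle equation. -/
theorem interior_eq_zero_of_isCartanCocycle {μ : torusAlgebra →ₗ[ℝ] SmoothForm torusLineModel TorusLine 1}
    (h : IsCartanCocycle (m := 1) torusVolumeForm μ) (x : torusAlgebra) (p : TorusLine) :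
    (μ x : RawForm torusLineModel TorusLine 1) p (fun _ => generator x p) = 0 := by
  have h1 := DFunLike.congr_fun (congrFun (congrFun (congrFun h.closed x) 0) p) ![]
  have h2 : cartanDifferential (fun x : torusAlgebra =>
    (Pi.single (1 + 2) (torusVolumeForm : RawForm torusLineModel TorusLine (1 + 2)) -
      Pi.single 1 (μ x : RawForm torusLineModel TorusLine 1) :
      InhomForm torusLineModel TorusLine)) x 0 =
      interior (generator x) (μ x : RawForm torusLineModel TorusLine 1) := by
    change (0 : RawForm torusLineModel TorusLine 0) - interior (generator x) (_ - _) = _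
    rw [Pi.single_eq_same, Pi.single_eq_of_ne (by decide)]
    funext p
    ext w
    change (0 : ℝ) - ((0 : ℝ) - _) = _
    rw [sub_sub_cancel]
    rfl
  rw [h2] at h1
  refine Eq.trans (congrArg ((μ x : RawForm torusLineModel TorusLine 1) p) ?_) h1
  funext i
  fin_cases i
  rfl

theorem not_areEquivalent_torusMoment {μ : torusAlgebra →ₗ[ℝ] SmoothForm torusLineModel TorusLine 1}
    (hμ : IsCartanCocycle (m := 1) torusVolumeForm μ)
    {f' : TotalCochain torusModel Torus torusLineModel TorusLine 2}
    (hf' : ArisesFrom (m := 1) μ f') :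
    ¬ AreEquivalent (m := 1) torusVolumeForm torusMoment torusVolumeForm f' := by
  rintro ⟨η, α, -, -, hη⟩
  have hs : varsigma (0 + 1) = 1 := by norm_num [varsigma]
  let x : Fin 1 → torusAlgebra := fun _ => basis₁
  let σ := η 0 0 rfl x
  obtain ⟨p, hp⟩ := exists_mvfderiv_generator_basis₁_eq_zero (mdifferentiable_zeroForm σ.2)
  let v : TangentSpace torusLineModel p := generator basis₁ p
  have h1 := DFunLike.congr_fun (congrFun (hη 0 1 rfl x) p) (fun _ => v)
  have h2 : (f' 0 1 rfl x : RawForm torusLineModel TorusLine 1) p (fun _ => v) = 0 := by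
    rw [hf' 0 1 rfl x, hs]
    exact (one_mul _).trans (interior_eq_zero_of_isCartanCocycle hμ basis₁ p)
  have h3 : (torusMoment 0 1 rfl x : RawForm torusLineModel TorusLine 1) p (fun _ => v) = -1 := by
    refine (moment₁_apply basis₁ p (fun _ => v)).trans ?_
    simp only [v, dθ₁_generator, dθ₂_generator, coord₁_basis₁, coord₂_basis₁]
    ring
  have h4 : extDer (σ : RawForm torusLineModel TorusLine 0) p (fun _ => v) = 0 :=
    (extDer_zeroForm_apply σ.2 p _).trans hp
  -- The contribution of `α̃` is `α(v, v) = 0`.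
  have h5 : (α : RawForm torusLineModel TorusLine 2) p (Fin.cons v (fun _ : Fin 1 => v)) = 0 :=
    ((α : RawForm torusLineModel TorusLine 2) p).map_eq_zero_of_eq _ (i := 0) (j := 1) rfl
      (by decide)
  rw [hs] at h1
  replace h1 : 1 * (f' 0 1 rfl x : RawForm torusLineModel TorusLine 1) p (fun _ => v) -
      1 * (torusMoment 0 1 rfl x : RawForm torusLineModel TorusLine 1) p (fun _ => v) =
      -extDer (σ : RawForm torusLineModel TorusLine 0) p (fun _ => v) +
      (-1 : ℝ) ^ 0 * (α : RawForm torusLineModel TorusLine 2) p (Fin.cons v (fun _ : Fin 1 => v)) := h1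
  rw [h2, h3, h4, h5] at h1
  norm_num at h1

end Obstruction

end MomentMap
end

theorem mainTheorem11 :
    ∃ ω : SmoothForm torusLineModel TorusLine 3,
      (ω : RawForm torusLineModel TorusLine 3) = torusVolume ∧
      extDer (ω : RawForm torusLineModel TorusLine 3) = 0 ∧
      MomentMap.IsInvariant Torus (ω : RawForm torusLineModel TorusLine 3) ∧
      ∃ f : TotalCochain torusModel Torus torusLineModel TorusLine 2,
        IsMomentMap (ω : RawForm torusLineModel TorusLine 3) f ∧
        IsEquivariant f ∧
        ∀ μ : GroupLieAlgebra torusModel Torus →ₗ[ℝ] SmoothForm torusLineModel TorusLine 1,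
          IsCartanCocycle (m := 1) ω μ →
          ∀ f' : TotalCochain torusModel Torus torusLineModel TorusLine 2,
            ArisesFrom (m := 1) μ f' →
            ¬ AreEquivalent (m := 1) ω f ω f' :=
  ⟨torusVolumeForm, rfl, extDer_eq_zero_of_finrank_lt (by simp) _, isInvariant_torusVolume,
    torusMoment, isMomentMap_torusMoment, isEquivariant_torusMoment,
    fun _ hμ _ hf' => not_areEquivalent_torusMoment hμ hf'⟩
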